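/- **Convergence of tabular Q-learning with shared experience (DASE).** Let $(\mathcal S,\mathcal A,p,r)$ be a finite Markov decision process with transition probabilities $p(s'\mid s,a)$ and a deterministic reward function $r(s,a)$, let $\gamma\in[0,1)$, and let $Q^*(s,a)=\sup_\pi Q^\pi(s,a)$, where $Q^\pi(s,a)=\mathbb E_\pi\big[\sum_{k\ge 0}\gamma^k r(s_k,a_k)\mid s_0=s,\,a_0=a\big]$ and $\pi$ ranges over the stationary (possibly randomized) policies. There are $K$ agents; fix one of them, $i$. On a probability space with an increasing sequence of $\sigma$-fields $(\mathcal P_t)_{t\ge 0}$, at its update step $t=0,1,2,\dots$ agent $i$ processes a batch of transitions $(s_{t,b},a_{t,b},r(s_{t,b},a_{t,b}),s'_{t,b})$, $b\in B$, with $B$ a finite index set (a single transition per step is the case $|B|=1$). Transition $b$ was executed by agent $j_{t,b}$; it is called internal if $j_{t,b}=i$ and external otherwise. It has a learning rate $\eta_{t,b}\in[0,1]$ and a similarity (DPS) weight $\lambda_{t,b}\in[0,1]$; put $w_{t,b}=1$ for internal and $w_{t,b}=\lambda_{t,b}$ for external transitions. The initial table $Q_0$ is $\mathcal P_0$-measurable,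 $j_{t,b},s_{t,b},a_{t,b},\eta_{t,b},\lambda_{t,b}$ are $\mathcal P_t$-measurable and $s'_{t,b}$ is $\mathcal P_{t+1}$-measurable. The table of agent $i$ is updated, for all $(s,a)\in\mathcal S\times\mathcal A$, by $$Q_{t+1}(s,a)=Q_t(s,a)+\frac1{|B|}\sum_{b\,:\,(s_{t,b},a_{t,b})=(s,a)}\eta_{t,b}\,w_{t,b}\Big[r(s,a)+\gamma\max_{a'\in\mathcal A}Q_t(s'_{t,b},a')-Q_t(s,a)\Big].$$ Assume: 1. (Sampling) Internal and external transitions are samples of the same MDP: $\mathbb P(s'_{t,b}=y\mid\mathcal P_t)=p(y\mid s_{t,b},a_{t,b})$ almost surely, for all $t,b,y$. 2. (Robbins–Monro; infinitely many updates) For every $(s,a)\in\mathcal S\times\mathcal A$, almost surely, $$\sum_{t}\ \sum_{b\,:\,(s_{t,b},a_{t,b})=(s,a),\ j_{t,b}=i}\eta_{t,b}=\infty,\qquad \sum_{t}\ \sum_{b\,:\,(s_{t,b},a_{t,b})=(s,a)}\eta_{t,b}^2<\infty .$$ In particular every state–action pair is visited and updated infinitely often by internal transitions. Then, almost surely, $Q_t(s,a)\to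 Q^*(s,a)$ as $t\to\infty$ for all $(s,a)\in\mathcal S\times\mathcal A$. -/

import Mathlib

open MeasureTheory ProbabilityTheory Filter Topology

/-- A finite Markov decision process `(S, A, p, r)` with transition probabilities
`p s a s' = p(s' | s, a)` and a deterministic reward function `r`. -/
structure FiniteMDP (S A : Type*) [Fintype S] where
  /-- transition probabilities -/
  p : S → A → S → ℝ
  /-- reward function -/
  r : S → A → ℝ
  p_nonneg : ∀ s a s', 0 ≤ p s a s'
  p_sum : ∀ s a, ∑ s', p s a s' = 1

/-- A (stationary, possibly randomized) policy: `prob s a = π(a | s)`. Deterministic policies are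
the ones with values in `{0, 1}`. -/
structure Policy (S A : Type*) [Fintype A] where
  /-- action probabilities -/
  prob : S → A → ℝ
  prob_nonneg : ∀ s a, 0 ≤ prob s a
  prob_sum : ∀ s, ∑ a, prob s a = 1

namespace FiniteMDP

variable {S A : Type*} [Fintype S] [Fintype A] [DecidableEq S] [DecidableEq A]

/-- The transition matrix of the Markov chain `(s_t, a_t)` of state-action pairs under the policy
`π`, that is `s_{t+1} ∼ p(· | s_t, a_t)` and `a_{t+1} ∼ π(· | s_{t+1})`. The entry `(x, y)` of its
`t`-th power is the probability that `(s_t, a_t) = y` given `(s_0, a_0) = x`. -/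
def stepMatrix (M : FiniteMDP S A) (π : Policy S A) : Matrix (S × A) (S × A) ℝ :=
  Matrix.of fun x y => M.p x.1 x.2 y.1 * π.prob y.1 y.2

/-- The action-value function of `π`: the expected discounted return
`Q^π(s, a) = ∑_t γ^t 𝔼[r(s_t, a_t) | s_0 = s, a_0 = a]`. -/
noncomputable def qPolicy (M : FiniteMDP S A) (γ : ℝ) (π : Policy S A) (s : S) (a : A) : ℝ :=
  ∑' t : ℕ, γ ^ t * ∑ y : S × A, (M.stepMatrix π ^ t) (s, a) y * M.r y.1 y.2

/-- The optimal action-value function `Q^*(s, a) = sup_π Q^π(s, a)`. -/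
noncomputable def qStar (M : FiniteMDP S A) (γ : ℝ) (s : S) (a : A) : ℝ :=
  ⨆ π : Policy S A, M.qPolicy γ π s a

/-- The temporal-difference error `r(s, a) + γ max_{a'} Q(s', a') - Q(s, a)` of the table `Q` on
the transition `(s, a, r(s, a), s')`. -/
noncomputable def tdError [Nonempty A] (M : FiniteMDP S A) (γ : ℝ) (Q : S → A → ℝ)
    (s : S) (a : A) (s' : S) : ℝ :=
  M.r s a + γ * Finset.univ.sup' Finset.univ_nonempty (Q s') - Q s a

/-- The weight that agent `i` gives to a transition executed by agent `j`: internal transitions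
have weight `1`, external ones are weighted by their similarity weight `lam`. -/
def shareWeight {K : ℕ} (i j : Fin K) (lam : ℝ) : ℝ :=
  if j = i then 1 else lam

/-- One tabular Q-learning update of agent `i` with shared experience, from the table `Q` and a
batch of transitions indexed by `B`. The transition `b` was executed by the agent `owner b`; it went
from the state `st b` under the action `ac b` to the state `nx b`; its learning rate is `η b` and
its similarity weight `lam b`. The temporal-difference errors of internal transitions and the
weighted ones of external transitions are averaged over the batch, each acting on the table entry
of its own state-action pair. -/
noncomputable def daseStep [Nonempty A] {K : ℕ} {B : Type*} [Fintype B]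
    (M : FiniteMDP S A) (γ : ℝ) (i : Fin K) (owner : B → Fin K) (st : B → S) (ac : B → A)
    (nx : B → S) (η lam : B → ℝ) (Q : S → A → ℝ) (s : S) (a : A) : ℝ :=
  Q s a + (Fintype.card B : ℝ)⁻¹ * ∑ b : B,
    if st b = s ∧ ac b = a then
      η b * shareWeight i (owner b) (lam b) * M.tdError γ Q s a (nx b)
    else 0

end FiniteMDP

/-
`Q^*` is the fixed point of the Bellman optimality operator, a sup-norm contraction, and each entry
of the table moves towards the operator by the fraction `α_t`, the total learning coefficient of the
batch, up to the sampling noise. The iterates are bounded, so the noise is a martingale difference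
with square-summable predictable coefficients and its series converges almost surely, after
truncation, by the `L²` martingale convergence theorem. On such a path the contraction drives the
table, corrected by the tail of the noise series, to the fixed point, because `∑ α_t` diverges
already over the internal transitions.
-/

section Averaging

variable {α x : ℕ → ℝ} {c ε : ℝ}

theorem tendsto_prod_one_sub_zero (hα : ∀ t, α t ≤ 1)
    (hdiv : Tendsto (fun n => ∑ t ∈ Finset.range n, α t) atTop atTop) :
    Tendsto (fun n => ∏ t ∈ Finset.range n, (1 - α t)) atTop (𝓝 0) := by
  refine squeeze_zero (fun n => Finset.prod_nonneg fun t _ => sub_nonneg.2 (hα t)) (fun n => ?_)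
    (Real.tendsto_exp_neg_atTop_nhds_zero.comp hdiv)
  calc ∏ t ∈ Finset.range n, (1 - α t) ≤ ∏ t ∈ Finset.range n, Real.exp (-α t) :=
        Finset.prod_le_prod (fun t _ => sub_nonneg.2 (hα t)) fun t _ => Real.one_sub_le_exp_neg _
    _ = Real.exp (-∑ t ∈ Finset.range n, α t) := by
        rw [← Real.exp_sum, Finset.sum_neg_distrib]

theorem eventually_le_add_of_forall_averaging_le (hα : ∀ t, α t ≤ 1)
    (hdiv : Tendsto (fun n => ∑ t ∈ Finset.range n, α t) atTop atTop)
    (hx : ∀ t, x (t + 1) ≤ (1 - α t) * x t + α t * c) (hε : 0 < ε) :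
    ∀ᶠ t in atTop, x t ≤ c + ε := by
  have hprod : ∀ n, x n - c ≤ (∏ t ∈ Finset.range n, (1 - α t)) * (x 0 - c) := by
    intro n
    induction n with
    | zero => simp
    | succ n ih =>
      calc x (n + 1) - c ≤ (1 - α n) * (x n - c) := by linarith [hx n]
        _ ≤ (1 - α n) * ((∏ t ∈ Finset.range n, (1 - α t)) * (x 0 - c)) :=
            mul_le_mul_of_nonneg_left ih (sub_nonneg.2 (hα n))
        _ = _ := by rw [Finset.prod_range_succ]; ring
  have hlim : Tendsto (fun n => (∏ t ∈ Finset.range n, (1 - α t)) * (x 0 - c)) atTop (𝓝 0) := by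
    simpa only [zero_mul] using (tendsto_prod_one_sub_zero hα hdiv).mul_const (x 0 - c)
  filter_upwards [hlim.eventually_lt_const hε] with n hn
  linarith [hprod n]

theorem eventually_le_add_of_eventually_averaging_le (hα : ∀ t, α t ≤ 1)
    (hdiv : Tendsto (fun n => ∑ t ∈ Finset.range n, α t) atTop atTop)
    (hx : ∀ᶠ t in atTop, x (t + 1) ≤ (1 - α t) * x t + α t * c) (hε : 0 < ε) :
    ∀ᶠ t in atTop, x t ≤ c + ε := by
  obtain ⟨N, hN⟩ := eventually_atTop.1 hx
  have hshift : Tendsto (fun n => ∑ t ∈ Finset.range n, α (N + t)) atTop atTop := by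
    have htail := tendsto_atTop_add_const_left atTop (-∑ t ∈ Finset.range N, α t)
      (hdiv.comp (tendsto_add_atTop_nat N))
    refine htail.congr fun n => ?_
    rw [Function.comp_apply, add_comm n N, Finset.sum_range_add, neg_add_cancel_left]
  have hev := eventually_le_add_of_forall_averaging_le (x := fun t => x (N + t))
    (fun t => hα (N + t)) hshift (fun t => hN (N + t) (N.le_add_right t)) hε
  filter_upwards [(tendsto_sub_atTop_nat N).eventually hev, eventually_ge_atTop N] with t ht hNt
  rwa [Nat.add_sub_cancel' hNt] at ht

end Averaging

section AsynchronousContraction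

variable {X E : Type*} [Fintype X] {γ C : ℝ} {α : ℕ → X → ℝ}

section Seminormed

variable [SeminormedAddCommGroup E] {z : ℕ → X → E} {ε : ℕ → ℝ}

theorem norm_le_max_of_asynchronous_contraction (hγ0 : 0 ≤ γ) (hγ1 : γ < 1)
    (hα : ∀ t x, α t x ∈ Set.Icc (0 : ℝ) 1)
    (hz : ∀ t x, ‖z (t + 1) x‖ ≤ (1 - α t x) * ‖z t x‖ + α t x * (γ * ‖z t‖ + C)) (t : ℕ) :
    ‖z t‖ ≤ max ‖z 0‖ (C / (1 - γ)) := by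
  set m := max ‖z 0‖ (C / (1 - γ))
  have hC : C ≤ m * (1 - γ) := (div_le_iff₀ (by linarith)).1 (le_max_right _ _)
  induction t with
  | zero => exact le_max_left _ _
  | succ t ih =>
    refine (pi_norm_le_iff_of_nonneg ((norm_nonneg _).trans ih)).2 fun x => (hz t x).trans ?_
    have htarget : γ * ‖z t‖ + C ≤ m := by
      linarith [mul_le_mul_of_nonneg_left ih hγ0]
    calc (1 - α t x) * ‖z t x‖ + α t x * (γ * ‖z t‖ + C)
        ≤ (1 - α t x) * m + α t x * m :=
          add_le_add (mul_le_mul_of_nonneg_left ((norm_le_pi_norm _ x).trans ih)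
            (sub_nonneg.2 (hα t x).2)) (mul_le_mul_of_nonneg_left htarget (hα t x).1)
      _ = m := by ring

theorem eventually_norm_le_mul_of_asynchronous_contraction (hγ0 : 0 ≤ γ) (hγ1 : γ < 1)
    (hα : ∀ t x, α t x ∈ Set.Icc (0 : ℝ) 1)
    (hdiv : ∀ x, Tendsto (fun n => ∑ t ∈ Finset.range n, α t x) atTop atTop)
    (hε : Tendsto ε atTop (𝓝 0))
    (hz : ∀ t x, ‖z (t + 1) x‖ ≤ (1 - α t x) * ‖z t x‖ + α t x * (γ * ‖z t‖ + ε t))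
    {c : ℝ} (hc : 0 < c) (hzc : ∀ᶠ t in atTop, ‖z t‖ ≤ c) :
    ∀ᶠ t in atTop, ‖z t‖ ≤ (1 + γ) / 2 * c := by
  have hδ : 0 < (1 - γ) / 4 * c := mul_pos (by linarith) hc
  have hcoord : ∀ x, ∀ᶠ t in atTop, ‖z t x‖ ≤ (γ * c + (1 - γ) / 4 * c) + (1 - γ) / 4 * c := by
    intro x
    refine eventually_le_add_of_eventually_averaging_le (fun t => (hα t x).2) (hdiv x) ?_ hδ
    filter_upwards [hzc, hε.eventually_le_const hδ] with t hzt hεt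
    have hαt := (hα t x).1
    refine (hz t x).trans ?_
    gcongr
  filter_upwards [eventually_all.2 hcoord] with t ht
  exact (pi_norm_le_iff_of_nonneg (by positivity)).2 fun x => (ht x).trans (by linarith)

theorem tendsto_zero_of_asynchronous_contraction (hγ0 : 0 ≤ γ) (hγ1 : γ < 1)
    (hα : ∀ t x, α t x ∈ Set.Icc (0 : ℝ) 1)
    (hdiv : ∀ x, Tendsto (fun n => ∑ t ∈ Finset.range n, α t x) atTop atTop)
    (hε : Tendsto ε atTop (𝓝 0))
    (hz : ∀ t x, ‖z (t + 1) x‖ ≤ (1 - α t x) * ‖z t x‖ + α t x * (γ * ‖z t‖ + ε t)) :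
    Tendsto z atTop (𝓝 0) := by
  obtain ⟨C, hC⟩ := hε.bddAbove_range
  set m := max ‖z 0‖ (C / (1 - γ)) + 1
  have hzm : ∀ t, ‖z t‖ ≤ m := fun t => by
    refine (norm_le_max_of_asynchronous_contraction (C := C) hγ0 hγ1 hα (fun t x => ?_) t).trans
      (lt_add_one _).le
    have hαt := (hα t x).1
    exact (hz t x).trans (by gcongr; exact hC ⟨t, rfl⟩)
  have hm : 0 < m := add_pos_of_nonneg_of_pos (le_max_of_le_left (norm_nonneg _)) one_pos
  have hρ : 0 < (1 + γ) / 2 := by linarith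
  have hiter : ∀ n : ℕ, ∀ᶠ t in atTop, ‖z t‖ ≤ ((1 + γ) / 2) ^ n * m := by
    intro n
    induction n with
    | zero => simpa only [pow_zero, one_mul] using Eventually.of_forall hzm
    | succ n ih =>
      simpa only [pow_succ', mul_assoc] using
        eventually_norm_le_mul_of_asynchronous_contraction hγ0 hγ1 hα hdiv hε hz
          (mul_pos (pow_pos hρ n) hm) ih
  have hpow : Tendsto (fun n : ℕ => ((1 + γ) / 2) ^ n * m) atTop (𝓝 0) := by
    simpa only [zero_mul] using
      (tendsto_pow_atTop_nhds_zero_of_lt_one hρ.le (by linarith)).mul_const m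
  rw [tendsto_zero_iff_norm_tendsto_zero]
  refine tendsto_order.2 ⟨fun a ha => Eventually.of_forall fun t => ha.trans_le (norm_nonneg _),
    fun δ hδ => ?_⟩
  obtain ⟨n, hn⟩ := (hpow.eventually_lt_const hδ).exists
  exact (hiter n).mono fun t ht => ht.trans_lt hn

end Seminormed

-- Subtracting the tail of the noise series leaves an exact asynchronous iteration of `F` whose
-- argument is perturbed by a vanishing amount.
theorem tendsto_fixedPoint_of_asynchronous_approximation [NormedAddCommGroup E] [NormedSpace ℝ E]
    {F : (X → E) → X → E} {K : NNReal} (hF : ContractingWith K F) {p : X → E}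
    (hp : Function.IsFixedPt F p) {q ξ : ℕ → X → E} (hα : ∀ t x, α t x ∈ Set.Icc (0 : ℝ) 1)
    (hdiv : ∀ x, Tendsto (fun n => ∑ t ∈ Finset.range n, α t x) atTop atTop)
    (hξ : ∀ x, ∃ L, Tendsto (fun n => ∑ t ∈ Finset.range n, ξ t x) atTop (𝓝 L))
    (hq : ∀ t x, q (t + 1) x = q t x + α t x • (F (q t) x - q t x) + ξ t x) :
    Tendsto q atTop (𝓝 p) := by
  choose L hL using hξ
  set D : ℕ → X → E := fun n x => ∑ t ∈ Finset.range n, ξ t x - L x with hD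
  have hD0 : Tendsto D atTop (𝓝 0) := tendsto_pi_nhds.2 fun x => tendsto_sub_nhds_zero_iff.2 (hL x)
  set z : ℕ → X → E := fun t => q t - D t - p with hz
  have hzsucc : ∀ t x, z (t + 1) x =
      (1 - α t x) • z t x + α t x • ((F (q t) - F p) x - D t x) := by
    intro t x
    simp only [hz, hD, hp.eq, Pi.sub_apply, hq, Finset.sum_range_succ]
    module
  have hFq : ∀ t x, ‖(F (q t) - F p) x - D t x‖ ≤ K * ‖z t‖ + 2 * ‖D t‖ := by
    intro t x
    have hqp : ‖q t - p‖ ≤ ‖z t‖ + ‖D t‖ := by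
      rw [show q t - p = z t + D t by simp only [hz]; abel]
      exact norm_add_le _ _
    have hKD : K * ‖D t‖ ≤ ‖D t‖ := mul_le_of_le_one_left (norm_nonneg _) hF.1.le
    calc ‖(F (q t) - F p) x - D t x‖ ≤ ‖F (q t) - F p‖ + ‖D t‖ :=
          (norm_sub_le _ _).trans (add_le_add (norm_le_pi_norm _ x) (norm_le_pi_norm _ x))
      _ ≤ K * ‖q t - p‖ + ‖D t‖ := by grw [hF.2.norm_sub_le]
      _ ≤ K * (‖z t‖ + ‖D t‖) + ‖D t‖ := by gcongr
      _ ≤ K * ‖z t‖ + 2 * ‖D t‖ := by linarith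
  have hz0 : Tendsto z atTop (𝓝 0) := by
    refine tendsto_zero_of_asynchronous_contraction K.2 hF.1 hα hdiv
      (ε := fun t => 2 * ‖D t‖) (by simpa using hD0.norm.const_mul 2) fun t x => ?_
    have hαt := hα t x
    rw [hzsucc]
    refine (norm_add_le _ _).trans ?_
    rw [norm_smul_of_nonneg (sub_nonneg.2 hαt.2), norm_smul_of_nonneg hαt.1]
    exact add_le_add_right (mul_le_mul_of_nonneg_left (hFq t x) hαt.1) _
  have hsum := (hz0.add hD0).add_const p
  simp only [add_zero, zero_add] at hsum
  exact hsum.congr fun t => by simp only [hz]; abel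

end AsynchronousContraction

theorem abs_sum_mul_le_of_sum_eq_one {ι : Type*} [Fintype ι] {w f : ι → ℝ} {c : ℝ}
    (hw : ∀ i, 0 ≤ w i) (hw1 : ∑ i, w i = 1) (hf : ∀ i, |f i| ≤ c) : |∑ i, w i * f i| ≤ c := by
  simpa using (convex_closedBall (0 : ℝ) c).sum_mem (fun i _ => hw i) hw1
    fun i _ => by simpa using hf i

section DiscountedReturn

open Matrix

variable {X : Type*} [Fintype X] [DecidableEq X] {P : Matrix X X ℝ} {γ : ℝ}

theorem norm_mulVec_le_of_mem_rowStochastic (hP : P ∈ rowStochastic ℝ X) (f : X → ℝ) :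
    ‖P *ᵥ f‖ ≤ ‖f‖ :=
  (pi_norm_le_iff_of_nonneg (norm_nonneg f)).2 fun x =>
    abs_sum_mul_le_of_sum_eq_one (fun _ => nonneg_of_mem_rowStochastic hP)
      (sum_row_of_mem_rowStochastic hP x) (norm_le_pi_norm f)

theorem summable_pow_smul_pow_mulVec (hP : P ∈ rowStochastic ℝ X) (hγ0 : 0 ≤ γ) (hγ1 : γ < 1)
    (r : X → ℝ) : Summable fun t : ℕ => γ ^ t • (P ^ t *ᵥ r) := by
  refine Summable.of_norm_bounded ((summable_geometric_of_lt_one hγ0 hγ1).mul_right ‖r‖)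
    fun t => ?_
  rw [norm_smul_of_nonneg (pow_nonneg hγ0 t)]
  exact mul_le_mul_of_nonneg_left (norm_mulVec_le_of_mem_rowStochastic (pow_mem hP t) r)
    (pow_nonneg hγ0 t)

theorem tsum_pow_smul_pow_mulVec (hP : P ∈ rowStochastic ℝ X) (hγ0 : 0 ≤ γ) (hγ1 : γ < 1)
    (r : X → ℝ) : ∑' t : ℕ, γ ^ t • (P ^ t *ᵥ r) =
      r + γ • (P *ᵥ ∑' t : ℕ, γ ^ t • (P ^ t *ᵥ r)) := by
  have hsum := summable_pow_smul_pow_mulVec hP hγ0 hγ1 r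
  have hmap : P *ᵥ ∑' t : ℕ, γ ^ t • (P ^ t *ᵥ r) = ∑' t : ℕ, P *ᵥ (γ ^ t • (P ^ t *ᵥ r)) :=
    (LinearMap.toContinuousLinearMap P.mulVecLin).map_tsum hsum
  rw [hmap, ← tsum_const_smul'', hsum.tsum_eq_zero_add]
  simp only [pow_zero, one_smul, one_mulVec, pow_succ', mulVec_smul, mulVec_mulVec, smul_smul]

theorem nonneg_of_smul_mulVec_le (hP : P ∈ rowStochastic ℝ X) (hγ0 : 0 ≤ γ) (hγ1 : γ < 1)
    {f : X → ℝ} (hf : γ • (P *ᵥ f) ≤ f) : 0 ≤ f := by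
  intro x
  have : Nonempty X := ⟨x⟩
  obtain ⟨x₀, hmin⟩ := Finite.exists_min f
  have havg : f x₀ ≤ (P *ᵥ f) x₀ :=
    calc f x₀ = ∑ y, P x₀ y * f x₀ := by
          rw [← Finset.sum_mul, sum_row_of_mem_rowStochastic hP, one_mul]
      _ ≤ ∑ y, P x₀ y * f y := Finset.sum_le_sum fun y _ =>
          mul_le_mul_of_nonneg_left (hmin y) (nonneg_of_mem_rowStochastic hP)
  have hdisc : γ * f x₀ ≤ f x₀ := (mul_le_mul_of_nonneg_left havg hγ0).trans (hf x₀)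
  exact (show 0 ≤ f x₀ by nlinarith).trans (hmin x)

theorem le_of_le_add_smul_mulVec_of_add_smul_mulVec_le (hP : P ∈ rowStochastic ℝ X)
    (hγ0 : 0 ≤ γ) (hγ1 : γ < 1) {r u v : X → ℝ} (hu : u ≤ r + γ • (P *ᵥ u))
    (hv : r + γ • (P *ᵥ v) ≤ v) : u ≤ v := by
  refine sub_nonneg.1 (nonneg_of_smul_mulVec_le hP hγ0 hγ1 ?_)
  calc γ • (P *ᵥ (v - u)) = (r + γ • (P *ᵥ v)) - (r + γ • (P *ᵥ u)) := by
        rw [mulVec_sub, smul_sub, add_sub_add_left_eq_sub]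
    _ ≤ v - u := sub_le_sub hv hu

end DiscountedReturn

namespace FiniteMDP

open Matrix

variable {S A : Type*} [Fintype A]

theorem stepMatrix_mulVec_apply [Fintype S] (M : FiniteMDP S A) (π : Policy S A) (f : S × A → ℝ)
    (x : S × A) : (M.stepMatrix π *ᵥ f) x =
      ∑ s, M.p x.1 x.2 s * ∑ a, π.prob s a * f (s, a) := by
  simp only [mulVec, dotProduct, stepMatrix, of_apply, Fintype.sum_prod_type, Finset.mul_sum,
    mul_assoc]

section Bellman

variable [Nonempty A]

/-- The value `max_a q(s, a)` of the state `s` under the table `q`. Tables are indexed by pairs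
here, so that the sup norm of `S × A → ℝ` applies to them. -/
noncomputable def stateValue (q : S × A → ℝ) (s : S) : ℝ :=
  Finset.univ.sup' Finset.univ_nonempty fun a => q (s, a)

theorem le_stateValue (q : S × A → ℝ) (s : S) (a : A) : q (s, a) ≤ stateValue q s :=
  Finset.le_sup' (fun a => q (s, a)) (Finset.mem_univ a)

theorem exists_eq_stateValue (q : S × A → ℝ) (s : S) : ∃ a, q (s, a) = stateValue q s := by
  obtain ⟨a, -, ha⟩ := Finset.univ.exists_mem_eq_sup' Finset.univ_nonempty fun a => q (s, a)
  exact ⟨a, ha.symm⟩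

variable [Fintype S]

theorem abs_stateValue_sub_stateValue_le (q q' : S × A → ℝ) (s : S) :
    |stateValue q s - stateValue q' s| ≤ ‖q - q'‖ := by
  have hle : ∀ u v : S × A → ℝ, stateValue u s ≤ ‖u - v‖ + stateValue v s := fun u v =>
    Finset.sup'_le _ _ fun a _ => by
      have huv : u (s, a) - v (s, a) ≤ ‖u - v‖ :=
        (le_abs_self _).trans (norm_le_pi_norm (u - v) (s, a))
      linarith [le_stateValue v s a]
  exact abs_sub_le_iff.2 ⟨sub_le_iff_le_add.2 (hle q q'),
    sub_le_iff_le_add.2 (norm_sub_rev q q' ▸ hle q' q)⟩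

theorem abs_stateValue_le (q : S × A → ℝ) (s : S) : |stateValue q s| ≤ ‖q‖ := by
  simpa [stateValue] using abs_stateValue_sub_stateValue_le q 0 s

/-- The Bellman optimality operator, whose fixed point is the optimal action-value function. -/
noncomputable def bellman (M : FiniteMDP S A) (γ : ℝ) (q : S × A → ℝ) (x : S × A) : ℝ :=
  M.r x.1 x.2 + γ * ∑ y, M.p x.1 x.2 y * stateValue q y

theorem contractingWith_bellman (M : FiniteMDP S A) {γ : ℝ} (hγ0 : 0 ≤ γ) (hγ1 : γ < 1) :
    ContractingWith ⟨γ, hγ0⟩ (M.bellman γ) := by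
  refine ⟨hγ1, LipschitzWith.of_dist_le_mul fun q q' => ?_⟩
  rw [dist_eq_norm, dist_eq_norm]
  refine (pi_norm_le_iff_of_nonneg (mul_nonneg hγ0 (norm_nonneg _))).2 fun x => ?_
  have hdiff : (M.bellman γ q - M.bellman γ q') x =
      γ * ∑ y, M.p x.1 x.2 y * (stateValue q y - stateValue q' y) := by
    simp only [Pi.sub_apply, bellman, mul_sub, Finset.sum_sub_distrib]
    ring
  rw [hdiff, Real.norm_eq_abs, abs_mul, abs_of_nonneg hγ0]
  exact mul_le_mul_of_nonneg_left (abs_sum_mul_le_of_sum_eq_one (M.p_nonneg _ _) (M.p_sum _ _)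
    (abs_stateValue_sub_stateValue_le q q')) hγ0

theorem add_smul_stepMatrix_mulVec_le_bellman (M : FiniteMDP S A) {γ : ℝ} (hγ0 : 0 ≤ γ)
    (π : Policy S A) (q : S × A → ℝ) :
    Function.uncurry M.r + γ • (M.stepMatrix π *ᵥ q) ≤ M.bellman γ q := by
  intro x
  have hπ : ∀ s, ∑ a, π.prob s a * q (s, a) ≤ stateValue q s := fun s =>
    calc ∑ a, π.prob s a * q (s, a) ≤ ∑ a, π.prob s a * stateValue q s :=
          Finset.sum_le_sum fun a _ =>
            mul_le_mul_of_nonneg_left (le_stateValue q s a) (π.prob_nonneg s a)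
      _ = stateValue q s := by rw [← Finset.sum_mul, π.prob_sum, one_mul]
  simp only [Pi.add_apply, Pi.smul_apply, smul_eq_mul, stepMatrix_mulVec_apply, bellman]
  exact add_le_add_right (mul_le_mul_of_nonneg_left (Finset.sum_le_sum fun s _ =>
    mul_le_mul_of_nonneg_left (hπ s) (M.p_nonneg _ _ s)) hγ0) _

theorem exists_policy_bellman_eq (M : FiniteMDP S A) (γ : ℝ) (q : S × A → ℝ) :
    ∃ π : Policy S A,
      M.bellman γ q = Function.uncurry M.r + γ • (M.stepMatrix π *ᵥ q) := by
  classical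
  choose greedy hgreedy using exists_eq_stateValue q
  refine ⟨{ prob := fun s a => if a = greedy s then 1 else 0
            prob_nonneg := fun s a => by split_ifs <;> norm_num
            prob_sum := fun s => by simp }, funext fun x => ?_⟩
  simp [bellman, stepMatrix_mulVec_apply, hgreedy, Function.uncurry]

end Bellman

variable [Fintype S] [DecidableEq S] [DecidableEq A]

theorem stepMatrix_mem_rowStochastic (M : FiniteMDP S A) (π : Policy S A) :
    M.stepMatrix π ∈ rowStochastic ℝ (S × A) := by
  refine ⟨fun x y => mul_nonneg (M.p_nonneg _ _ _) (π.prob_nonneg _ _), funext fun x => ?_⟩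
  simp only [stepMatrix_mulVec_apply, Pi.one_apply, mul_one, π.prob_sum, M.p_sum]

theorem uncurry_qPolicy_eq_tsum (M : FiniteMDP S A) {γ : ℝ} (hγ0 : 0 ≤ γ) (hγ1 : γ < 1)
    (π : Policy S A) : Function.uncurry (M.qPolicy γ π) =
      ∑' t : ℕ, γ ^ t • (M.stepMatrix π ^ t *ᵥ Function.uncurry M.r) := by
  ext x
  rw [tsum_apply (summable_pow_smul_pow_mulVec (M.stepMatrix_mem_rowStochastic π) hγ0 hγ1 _)]
  rfl

theorem uncurry_qPolicy_eq (M : FiniteMDP S A) {γ : ℝ} (hγ0 : 0 ≤ γ) (hγ1 : γ < 1)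
    (π : Policy S A) : Function.uncurry (M.qPolicy γ π) =
      Function.uncurry M.r + γ • (M.stepMatrix π *ᵥ Function.uncurry (M.qPolicy γ π)) := by
  rw [M.uncurry_qPolicy_eq_tsum hγ0 hγ1 π]
  exact tsum_pow_smul_pow_mulVec (M.stepMatrix_mem_rowStochastic π) hγ0 hγ1 _

variable [Nonempty A]

theorem uncurry_qPolicy_le_of_isFixedPt (M : FiniteMDP S A) {γ : ℝ} (hγ0 : 0 ≤ γ) (hγ1 : γ < 1)
    {q : S × A → ℝ} (hq : Function.IsFixedPt (M.bellman γ) q) (π : Policy S A) :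
    Function.uncurry (M.qPolicy γ π) ≤ q :=
  le_of_le_add_smul_mulVec_of_add_smul_mulVec_le (M.stepMatrix_mem_rowStochastic π) hγ0 hγ1
    (M.uncurry_qPolicy_eq hγ0 hγ1 π).le
    ((M.add_smul_stepMatrix_mulVec_le_bellman hγ0 π q).trans_eq hq)

theorem exists_policy_le_uncurry_qPolicy_of_isFixedPt (M : FiniteMDP S A) {γ : ℝ} (hγ0 : 0 ≤ γ)
    (hγ1 : γ < 1) {q : S × A → ℝ} (hq : Function.IsFixedPt (M.bellman γ) q) :
    ∃ π : Policy S A, q ≤ Function.uncurry (M.qPolicy γ π) := by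
  obtain ⟨π, hπ⟩ := M.exists_policy_bellman_eq γ q
  exact ⟨π, le_of_le_add_smul_mulVec_of_add_smul_mulVec_le (M.stepMatrix_mem_rowStochastic π)
    hγ0 hγ1 (hq.symm.trans hπ).le (M.uncurry_qPolicy_eq hγ0 hγ1 π).ge⟩

theorem isFixedPt_bellman_qStar (M : FiniteMDP S A) {γ : ℝ} (hγ0 : 0 ≤ γ) (hγ1 : γ < 1) :
    Function.IsFixedPt (M.bellman γ) (Function.uncurry (M.qStar γ)) := by
  have hcontr := M.contractingWith_bellman hγ0 hγ1
  have hfix := hcontr.fixedPoint_isFixedPt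
  set q := hcontr.fixedPoint
  obtain ⟨π, hπ⟩ := M.exists_policy_le_uncurry_qPolicy_of_isFixedPt hγ0 hγ1 hfix
  have hle := fun π' x => M.uncurry_qPolicy_le_of_isFixedPt hγ0 hγ1 hfix π' x
  have : Nonempty (Policy S A) := ⟨π⟩
  suffices hstar : Function.uncurry (M.qStar γ) = q by rwa [hstar]
  ext x
  exact le_antisymm (ciSup_le fun π' => hle π' x)
    ((hπ x).trans (le_ciSup (f := fun π' => M.qPolicy γ π' x.1 x.2)
      ⟨q x, Set.forall_mem_range.2 fun π' => hle π' x⟩ π))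

end FiniteMDP

section MartingaleDifference

theorem sum_mul_sq_le_of_abs_le {ι : Type*} {s : Finset ι} {a b : ι → ℝ} {C R : ℝ}
    (hb : ∀ i ∈ s, |b i| ≤ R) (hC : ∑ i ∈ s, a i ^ 2 ≤ C) :
    ∑ i ∈ s, (a i * b i) ^ 2 ≤ C * R ^ 2 :=
  calc ∑ i ∈ s, (a i * b i) ^ 2 ≤ ∑ i ∈ s, a i ^ 2 * R ^ 2 := Finset.sum_le_sum fun i hi => by
        rw [mul_pow, ← sq_abs (b i)]
        exact mul_le_mul_of_nonneg_left (pow_le_pow_left₀ (abs_nonneg _) (hb i hi) 2) (sq_nonneg _)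
    _ ≤ C * R ^ 2 := by
        rw [← Finset.sum_mul]
        exact mul_le_mul_of_nonneg_right hC (sq_nonneg R)

theorem sum_ite_sum_le_le {f : ℕ → ℝ} {C : ℝ} (hC : 0 ≤ C) (hf : ∀ t, 0 ≤ f t) (n : ℕ) :
    ∑ t ∈ Finset.range n, (if ∑ u ∈ Finset.range (t + 1), f u ≤ C then f t else 0) ≤ C := by
  induction n with
  | zero => simpa using hC
  | succ n ih =>
    by_cases h : ∑ u ∈ Finset.range (n + 1), f u ≤ C
    · refine (Finset.sum_le_sum fun t _ => ?_).trans h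
      split_ifs
      exacts [le_rfl, hf t]
    · rwa [Finset.sum_range_succ, if_neg h, add_zero]

variable {Ω : Type*} {m mΩ : MeasurableSpace Ω} {μ : Measure Ω} {ℱ : Filtration ℕ mΩ}

theorem condExp_mul_eq_zero_of_condExp_eq_zero {g d : Ω → ℝ} (hg : StronglyMeasurable[m] g)
    (hgd : Integrable (g * d) μ) (hd : Integrable d μ) (h0 : μ[d | m] =ᵐ[μ] 0) :
    μ[g * d | m] =ᵐ[μ] 0 := by
  simpa only [mul_zero] using
    (condExp_mul_of_stronglyMeasurable_left hg hgd hd).trans ((EventuallyEq.refl _ g).mul h0)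

theorem integral_eq_zero_of_condExp_eq_zero {E : Type*} [NormedAddCommGroup E] [NormedSpace ℝ E]
    [CompleteSpace E] (hm : m ≤ mΩ) [SigmaFinite (μ.trim hm)] {d : Ω → E}
    (h0 : μ[d | m] =ᵐ[μ] 0) : ∫ ω, d ω ∂μ = 0 := by
  rw [← integral_condExp hm, integral_congr_ae h0, Pi.zero_def, integral_zero]

theorem martingale_sum_of_condExp_eq_zero {E : Type*} [NormedAddCommGroup E] [NormedSpace ℝ E]
    [CompleteSpace E] [IsFiniteMeasure μ] {ξ : ℕ → Ω → E}
    (hξ : ∀ t, StronglyMeasurable[ℱ (t + 1)] (ξ t)) (hint : ∀ t, Integrable (ξ t) μ)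
    (h0 : ∀ t, μ[ξ t | ℱ t] =ᵐ[μ] 0) : Martingale (fun n => ∑ t ∈ Finset.range n, ξ t) ℱ μ := by
  refine martingale_of_condExp_sub_eq_zero_nat (fun n => ?_)
    (fun n => integrable_finsetSum' _ fun t _ => hint t) fun t => ?_
  · exact Finset.stronglyMeasurable_sum _ fun t ht =>
      (hξ t).mono (ℱ.mono (Finset.mem_range.1 ht))
  · rw [Finset.sum_range_succ_sub_sum]
    exact h0 t

theorem integral_add_sq_eq_of_integral_mul_eq_zero {X Y : Ω → ℝ} (hX : MemLp X 2 μ)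
    (hY : MemLp Y 2 μ) (hXY : ∫ ω, X ω * Y ω ∂μ = 0) :
    ∫ ω, (X ω + Y ω) ^ 2 ∂μ = ∫ ω, X ω ^ 2 ∂μ + ∫ ω, Y ω ^ 2 ∂μ := by
  have hsq := hX.integrable_sq.add hY.integrable_sq
  have hmul : Integrable (fun ω => 2 * (X ω * Y ω)) μ := (hX.integrable_mul hY).const_mul 2
  calc ∫ ω, (X ω + Y ω) ^ 2 ∂μ = ∫ ω, ((X ω ^ 2 + Y ω ^ 2) + 2 * (X ω * Y ω)) ∂μ := by
        congr with ω
        ring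
    _ = ∫ ω, X ω ^ 2 ∂μ + ∫ ω, Y ω ^ 2 ∂μ + 2 * ∫ ω, X ω * Y ω ∂μ := by
        rw [← integral_add hX.integrable_sq hY.integrable_sq, ← integral_const_mul]
        exact integral_add hsq hmul
    _ = ∫ ω, X ω ^ 2 ∂μ + ∫ ω, Y ω ^ 2 ∂μ := by rw [hXY, mul_zero, add_zero]

theorem integral_sum_sq_eq_of_condExp_eq_zero [IsFiniteMeasure μ] {ξ : ℕ → Ω → ℝ}
    (hξ : ∀ t, StronglyMeasurable[ℱ (t + 1)] (ξ t)) (hL2 : ∀ t, MemLp (ξ t) 2 μ)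
    (h0 : ∀ t, μ[ξ t | ℱ t] =ᵐ[μ] 0) (n : ℕ) :
    ∫ ω, ((∑ t ∈ Finset.range n, ξ t) ω) ^ 2 ∂μ =
      ∑ t ∈ Finset.range n, ∫ ω, ξ t ω ^ 2 ∂μ := by
  have hint : ∀ t, Integrable (ξ t) μ := fun t => (hL2 t).integrable one_le_two
  have hsumL2 : ∀ n, MemLp (∑ t ∈ Finset.range n, ξ t) 2 μ := fun n =>
    memLp_finsetSum' _ fun t _ => hL2 t
  induction n with
  | zero => simp
  | succ n ih =>
    have horth : ∫ ω, (∑ t ∈ Finset.range n, ξ t) ω * ξ n ω ∂μ = 0 :=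
      integral_eq_zero_of_condExp_eq_zero (ℱ.le n) (condExp_mul_eq_zero_of_condExp_eq_zero
        ((martingale_sum_of_condExp_eq_zero hξ hint h0).stronglyMeasurable n)
        ((hsumL2 n).integrable_mul (hL2 n)) (hint n) (h0 n))
    simp only [Finset.sum_range_succ, Pi.add_apply]
    rw [integral_add_sq_eq_of_integral_mul_eq_zero (hsumL2 n) (hL2 n) horth, ih]

theorem ae_exists_tendsto_of_integral_sq_le [IsFiniteMeasure μ] {X : ℕ → Ω → ℝ} {C : ℝ}
    (hX : Martingale X ℱ μ) (hL2 : ∀ n, MemLp (X n) 2 μ)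
    (hC : ∀ n, ∫ ω, X n ω ^ 2 ∂μ ≤ C) :
    ∀ᵐ ω ∂μ, ∃ L, Tendsto (fun n => X n ω) atTop (𝓝 L) := by
  refine hX.submartingale.exists_ae_tendsto_of_bdd (R := (μ.real Set.univ + C).toNNReal)
    fun n => ?_
  rw [eLpNorm_one_eq_lintegral_enorm, ← ofReal_integral_norm_eq_lintegral_enorm (hX.integrable n)]
  refine ENNReal.ofReal_le_ofReal ?_
  calc ∫ ω, ‖X n ω‖ ∂μ ≤ ∫ ω, (1 + X n ω ^ 2) ∂μ := by
        refine integral_mono (hX.integrable n).norm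
          ((integrable_const 1).add (hL2 n).integrable_sq) fun ω => ?_
        rw [Real.norm_eq_abs, ← sq_abs]
        nlinarith [sq_nonneg (|X n ω| - 1)]
    _ = μ.real Set.univ + ∫ ω, X n ω ^ 2 ∂μ := by
        rw [integral_add (integrable_const 1) (hL2 n).integrable_sq, integral_const,
          smul_eq_mul, mul_one]
    _ ≤ μ.real Set.univ + C := by grw [hC n]

theorem ae_exists_tendsto_sum_mul_of_sum_sq_le [IsFiniteMeasure μ] {g d : ℕ → Ω → ℝ} {C R : ℝ}
    (hg : StronglyAdapted ℱ g) (hC : ∀ n ω, ∑ t ∈ Finset.range n, g t ω ^ 2 ≤ C)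
    (hd : ∀ t, StronglyMeasurable[ℱ (t + 1)] (d t)) (hR : ∀ t, ∀ᵐ ω ∂μ, |d t ω| ≤ R)
    (h0 : ∀ t, μ[d t | ℱ t] =ᵐ[μ] 0) :
    ∀ᵐ ω ∂μ, ∃ L, Tendsto (fun n => ∑ t ∈ Finset.range n, g t ω * d t ω) atTop (𝓝 L) := by
  have hgC : ∀ t ω, |g t ω| ≤ √C := fun t ω => Real.abs_le_sqrt <|
    (Finset.single_le_sum (f := fun t => g t ω ^ 2) (fun _ _ => sq_nonneg _)
      (Finset.self_mem_range_succ t)).trans (hC (t + 1) ω)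
  have hdL : ∀ t, MemLp (d t) ⊤ μ := fun t =>
    memLp_top_of_bound ((hd t).mono (ℱ.le _)).aestronglyMeasurable R (hR t)
  have hgdL2 : ∀ t, MemLp (g t * d t) 2 μ := fun t =>
    ((hdL t).mul' (memLp_top_of_bound ((hg t).mono (ℱ.le t)).aestronglyMeasurable (√C)
      (Eventually.of_forall (hgC t)))).mono_exponent le_top
  have hgd : ∀ t, StronglyMeasurable[ℱ (t + 1)] (g t * d t) := fun t =>
    ((hg t).mono (ℱ.mono t.le_succ)).mul (hd t)
  have hgd0 : ∀ t, μ[g t * d t | ℱ t] =ᵐ[μ] 0 := fun t =>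
    condExp_mul_eq_zero_of_condExp_eq_zero (hg t) ((hgdL2 t).integrable one_le_two)
      ((hdL t).integrable le_top) (h0 t)
  have hsum : ∀ n, MemLp (∑ t ∈ Finset.range n, g t * d t) 2 μ := fun n =>
    memLp_finsetSum' _ fun t _ => hgdL2 t
  have hmart := martingale_sum_of_condExp_eq_zero hgd
    (fun t => (hgdL2 t).integrable one_le_two) hgd0
  have hvar : ∀ n, ∫ ω, ((∑ t ∈ Finset.range n, g t * d t) ω) ^ 2 ∂μ ≤
      μ.real Set.univ * (C * R ^ 2) := by
    intro n
    rw [integral_sum_sq_eq_of_condExp_eq_zero hgd hgdL2 hgd0,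
      ← integral_finsetSum _ fun t _ => (hgdL2 t).integrable_sq, ← smul_eq_mul, ← integral_const]
    refine integral_mono_ae (integrable_finsetSum _ fun t _ => (hgdL2 t).integrable_sq)
      (integrable_const _) ?_
    filter_upwards [ae_all_iff.2 hR] with ω hω
    exact sum_mul_sq_le_of_abs_le (fun t _ => hω t) (hC n ω)
  simpa only [Finset.sum_apply, Pi.mul_apply] using
    ae_exists_tendsto_of_integral_sq_le hmart hsum hvar

-- Truncating `g` when its accumulated squares exceed an integer reduces to bounded sums of
-- squares; almost every path is left unchanged by one of these countably many truncations.
theorem ae_exists_tendsto_sum_mul_of_summable_sq [IsFiniteMeasure μ] {g d : ℕ → Ω → ℝ} {R : ℝ}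
    (hg : StronglyAdapted ℱ g) (hsq : ∀ᵐ ω ∂μ, Summable fun t => g t ω ^ 2)
    (hd : ∀ t, StronglyMeasurable[ℱ (t + 1)] (d t)) (hR : ∀ t, ∀ᵐ ω ∂μ, |d t ω| ≤ R)
    (h0 : ∀ t, μ[d t | ℱ t] =ᵐ[μ] 0) :
    ∀ᵐ ω ∂μ, ∃ L, Tendsto (fun n => ∑ t ∈ Finset.range n, g t ω * d t ω) atTop (𝓝 L) := by
  set trunc : ℕ → ℕ → Ω → ℝ := fun N t =>
    {ω | ∑ u ∈ Finset.range (t + 1), g u ω ^ 2 ≤ N}.indicator (g t)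
  have htrunc : ∀ N, StronglyAdapted ℱ (trunc N) := fun N t =>
    (hg t).indicator <| measurableSet_le (Finset.measurable_sum _ fun u hu =>
      ((hg u).mono (ℱ.mono (Finset.mem_range_succ_iff.1 hu))).measurable.pow_const 2)
      measurable_const
  have htrunc_sq : ∀ (N n : ℕ) ω, ∑ t ∈ Finset.range n, trunc N t ω ^ 2 ≤ N := by
    intro N n ω
    simpa only [trunc, Set.indicator_apply, Set.mem_ofPred_eq, ite_pow, zero_pow two_ne_zero] using
      sum_ite_sum_le_le N.cast_nonneg (fun t => sq_nonneg (g t ω)) n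
  have hconv := ae_all_iff.2 fun N =>
    ae_exists_tendsto_sum_mul_of_sum_sq_le (htrunc N) (htrunc_sq N) hd hR h0
  filter_upwards [hconv, hsq] with ω hω hsqω
  obtain ⟨N, hN⟩ := exists_nat_ge (∑' t, g t ω ^ 2)
  have htrunc_eq : ∀ t, trunc N t ω = g t ω := fun t => by
    have hmem := (hsqω.sum_le_tsum (Finset.range (t + 1)) fun _ _ => sq_nonneg _).trans hN
    simp only [trunc, Set.indicator_apply, Set.mem_ofPred_eq, if_pos hmem]
  simpa only [htrunc_eq] using hω N

theorem ae_exists_tendsto_sum_mul_sub_condExp [IsFiniteMeasure μ] {g f : ℕ → Ω → ℝ} {R : ℝ}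
    (hg : StronglyAdapted ℱ g) (hsq : ∀ᵐ ω ∂μ, Summable fun t => g t ω ^ 2)
    (hf : ∀ t, StronglyMeasurable[ℱ (t + 1)] (f t)) (hR : ∀ t, ∀ᵐ ω ∂μ, |f t ω| ≤ R) :
    ∀ᵐ ω ∂μ, ∃ L, Tendsto (fun n => ∑ t ∈ Finset.range n,
      g t ω * (f t ω - (μ[f t | ℱ t]) ω)) atTop (𝓝 L) := by
  have hint : ∀ t, Integrable (f t) μ := fun t =>
    Integrable.of_bound ((hf t).mono (ℱ.le _)).aestronglyMeasurable R (hR t)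
  refine ae_exists_tendsto_sum_mul_of_summable_sq (d := fun t => f t - μ[f t | ℱ t])
    (R := R + R) hg hsq (fun t => (hf t).sub (stronglyMeasurable_condExp.mono (ℱ.mono t.le_succ)))
    (fun t => ?_) fun t => ?_
  · filter_upwards [hR t, ae_bdd_abs_condExp_of_ae_bdd_abs (m := ℱ t) (hR t)] with ω hω hcω
    exact (abs_sub _ _).trans (add_le_add hω hcω)
  · refine (condExp_sub (hint t) integrable_condExp (ℱ t)).trans ?_
    rw [condExp_of_stronglyMeasurable (ℱ.le t) stronglyMeasurable_condExp integrable_condExp,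
      sub_self]

end MartingaleDifference

namespace FiniteMDP

section BatchQLearning

variable {S A B Ω : Type*} [Fintype A] [Nonempty A]

theorem measurable_stateValue {m : MeasurableSpace Ω} {q : Ω → S × A → ℝ}
    (hq : ∀ x, Measurable fun ω => q ω x) (y : S) : Measurable fun ω => stateValue (q ω) y := by
  have hfun : (fun ω => stateValue (q ω) y) =
      Finset.univ.sup' Finset.univ_nonempty fun a ω => q ω (y, a) :=
    funext fun ω =>
      (Finset.sup'_apply Finset.univ_nonempty (fun a ω => q ω (y, a)) ω).symm
  rw [hfun]
  exact Finset.measurable_sup' _ fun a _ => hq (y, a)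

theorem measurable_stateValue_comp [Countable S] {m : MeasurableSpace Ω} {q : Ω → S × A → ℝ}
    (hq : ∀ x, Measurable fun ω => q ω x) {nx : Ω → S} (hnx : Measurable[m, ⊤] nx) :
    Measurable fun ω => stateValue (q ω) (nx ω) := by
  let _ : MeasurableSpace S := ⊤
  exact (measurable_from_prod_countable_left (f := fun z : Ω × S => stateValue (q z.1) z.2)
    (measurable_stateValue hq)).comp (measurable_id.prodMk hnx)

variable [Fintype S] [Fintype B] {mΩ : MeasurableSpace Ω}

/-- Batch Q-learning in a general form: at step `t` the entry `x` of the random table `q t` moves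
by `c t b ω x` times the temporal-difference error of each sample `b`, whose next state is
`nx t b`. The samples acting on `x`, those with `c t b ω x ≠ 0`, are drawn from the transition
probabilities of the MDP at `x` given the past. Tables and coefficients are indexed by pairs. -/
structure IsBatchQLearning (M : FiniteMDP S A) (γ : ℝ) (μ : Measure Ω) (ℱ : Filtration ℕ mΩ)
    (nx : ℕ → B → Ω → S) (c : ℕ → B → Ω → S × A → ℝ) (q : ℕ → Ω → S × A → ℝ) : Prop where
  measurable_coeff : ∀ t b x, Measurable[ℱ t] fun ω => c t b ω x
  coeff_nonneg : ∀ t b ω x, 0 ≤ c t b ω x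
  sum_coeff_le_one : ∀ t ω x, ∑ b, c t b ω x ≤ 1
  measurable_next : ∀ t b, Measurable[ℱ (t + 1), ⊤] (nx t b)
  condExp_next : ∀ t b x y, ∀ᵐ ω ∂μ, c t b ω x ≠ 0 →
    (μ[Set.indicator {ω | nx t b ω = y} (fun _ => (1 : ℝ)) | ℱ t]) ω = M.p x.1 x.2 y
  measurable_init : ∀ x, Measurable[ℱ 0] fun ω => q 0 ω x
  step : ∀ t ω x, q (t + 1) ω x = q t ω x +
    ∑ b, c t b ω x * (M.r x.1 x.2 + γ * stateValue (q t ω) (nx t b ω) - q t ω x)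

namespace IsBatchQLearning

variable {M : FiniteMDP S A} {γ : ℝ} {μ : Measure Ω} {ℱ : Filtration ℕ mΩ} {nx : ℕ → B → Ω → S}
  {c : ℕ → B → Ω → S × A → ℝ} {q : ℕ → Ω → S × A → ℝ}

theorem sum_coeff_mem_Icc (h : IsBatchQLearning M γ μ ℱ nx c q) (t : ℕ) (ω : Ω) (x : S × A) :
    ∑ b, c t b ω x ∈ Set.Icc (0 : ℝ) 1 :=
  ⟨Finset.sum_nonneg fun b _ => h.coeff_nonneg t b ω x, h.sum_coeff_le_one t ω x⟩

theorem measurable (h : IsBatchQLearning M γ μ ℱ nx c q) (t : ℕ) (x : S × A) :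
    Measurable[ℱ t] fun ω => q t ω x := by
  induction t generalizing x with
  | zero => exact h.measurable_init x
  | succ t ih =>
    have hle := ℱ.mono t.le_succ
    have hq : ∀ x, Measurable[ℱ (t + 1)] fun ω => q t ω x := fun x => (ih x).mono hle le_rfl
    simp only [h.step]
    exact (hq x).add (Finset.measurable_sum _ fun b _ =>
      ((h.measurable_coeff t b x).mono hle le_rfl).mul
        ((((measurable_stateValue_comp hq (h.measurable_next t b)).const_mul γ).const_add _).sub
          (hq x)))

theorem exists_forall_norm_le (h : IsBatchQLearning M γ μ ℱ nx c q) (hγ0 : 0 ≤ γ) (hγ1 : γ < 1)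
    (ω : Ω) : ∃ C, ∀ t, ‖q t ω‖ ≤ C := by
  refine ⟨_, norm_le_max_of_asynchronous_contraction hγ0 hγ1 (z := fun t => q t ω)
    (C := ‖Function.uncurry M.r‖) (fun t x => h.sum_coeff_mem_Icc t ω x) fun t x => ?_⟩
  have htarget : ∀ b, |M.r x.1 x.2 + γ * stateValue (q t ω) (nx t b ω)| ≤
      γ * ‖q t ω‖ + ‖Function.uncurry M.r‖ := fun b => by
    rw [add_comm (γ * _)]
    refine (abs_add_le _ _).trans (add_le_add (norm_le_pi_norm (Function.uncurry M.r) x) ?_)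
    rw [abs_mul, abs_of_nonneg hγ0]
    exact mul_le_mul_of_nonneg_left (abs_stateValue_le _ _) hγ0
  calc |q (t + 1) ω x|
      = |(1 - ∑ b, c t b ω x) * q t ω x +
          ∑ b, c t b ω x * (M.r x.1 x.2 + γ * stateValue (q t ω) (nx t b ω))| := by
        congr 1
        simp only [h.step, mul_sub, Finset.sum_sub_distrib, ← Finset.sum_mul]
        ring
    _ ≤ (1 - ∑ b, c t b ω x) * |q t ω x| +
          ∑ b, c t b ω x * |M.r x.1 x.2 + γ * stateValue (q t ω) (nx t b ω)| := by
        refine (abs_add_le _ _).trans (add_le_add ?_ ((Finset.abs_sum_le_sum_abs _ _).trans_eq ?_))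
        · rw [abs_mul, abs_of_nonneg (sub_nonneg.2 (h.sum_coeff_le_one t ω x))]
        · simp only [abs_mul, abs_of_nonneg (h.coeff_nonneg t _ ω x)]
    _ ≤ _ := by
        rw [Finset.sum_mul]
        exact add_le_add_right (Finset.sum_le_sum fun b _ =>
          mul_le_mul_of_nonneg_left (htarget b) (h.coeff_nonneg t b ω x)) _

theorem ae_step_eq_bellman_add_noise (h : IsBatchQLearning M γ μ ℱ nx c q) :
    ∀ᵐ ω ∂μ, ∀ t x, q (t + 1) ω x =
      q t ω x + (∑ b, c t b ω x) • (M.bellman γ (q t ω) x - q t ω x) +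
        ∑ b, ∑ y, γ * c t b ω x * stateValue (q t ω) y *
          (Set.indicator {ω | nx t b ω = y} (fun _ => (1 : ℝ)) ω -
            (μ[Set.indicator {ω | nx t b ω = y} (fun _ => (1 : ℝ)) | ℱ t]) ω) := by
  classical
  filter_upwards [ae_all_iff.2 fun t => ae_all_iff.2 fun b => ae_all_iff.2 fun x =>
    ae_all_iff.2 fun y => h.condExp_next t b x y] with ω hω t x
  rw [h.step, add_assoc, smul_eq_mul, Finset.sum_mul, ← Finset.sum_add_distrib]
  congr 1
  refine Finset.sum_congr rfl fun b _ => ?_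
  by_cases hc : c t b ω x = 0
  · simp [hc]
  · have hsample : ∑ y, γ * c t b ω x * stateValue (q t ω) y *
        Set.indicator {ω | nx t b ω = y} (fun _ => (1 : ℝ)) ω =
          γ * c t b ω x * stateValue (q t ω) (nx t b ω) := by
      simp [Set.indicator_apply]
    have hmean : ∑ y, γ * c t b ω x * stateValue (q t ω) y * M.p x.1 x.2 y =
        c t b ω x * (γ * ∑ y, M.p x.1 x.2 y * stateValue (q t ω) y) := by
      simp only [Finset.mul_sum]
      exact Finset.sum_congr rfl fun y _ => by ring
    simp only [hω t b x _ hc, bellman, mul_sub, Finset.sum_sub_distrib, hsample, hmean]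
    ring

theorem ae_exists_tendsto_sum_noise [IsFiniteMeasure μ] (h : IsBatchQLearning M γ μ ℱ nx c q)
    (hγ0 : 0 ≤ γ) (hγ1 : γ < 1) {b : B} {x : S × A}
    (hsq : ∀ᵐ ω ∂μ, Summable fun t => c t b ω x ^ 2) (y : S) :
    ∀ᵐ ω ∂μ, ∃ L, Tendsto (fun n => ∑ t ∈ Finset.range n,
      γ * c t b ω x * stateValue (q t ω) y *
        (Set.indicator {ω | nx t b ω = y} (fun _ => (1 : ℝ)) ω -
          (μ[Set.indicator {ω | nx t b ω = y} (fun _ => (1 : ℝ)) | ℱ t]) ω)) atTop (𝓝 L) := by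
  refine ae_exists_tendsto_sum_mul_sub_condExp (R := 1)
    (g := fun t ω => γ * c t b ω x * stateValue (q t ω) y)
    (fun t => (((h.measurable_coeff t b x).const_mul γ).mul
      (measurable_stateValue (h.measurable t) y)).stronglyMeasurable) ?_
    (fun t => stronglyMeasurable_const.indicator
      (h.measurable_next t b (show MeasurableSet[⊤] {y} from trivial)))
    fun t => Eventually.of_forall fun ω => ?_
  · filter_upwards [hsq] with ω hω
    obtain ⟨C, hC⟩ := h.exists_forall_norm_le hγ0 hγ1 ω
    refine Summable.of_nonneg_of_le (fun _ => sq_nonneg _) (fun t => ?_)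
      (hω.mul_left ((γ * C) ^ 2))
    have hV : |γ * stateValue (q t ω) y| ≤ γ * C := by
      rw [abs_mul, abs_of_nonneg hγ0]
      exact mul_le_mul_of_nonneg_left ((abs_stateValue_le _ y).trans (hC t)) hγ0
    calc (γ * c t b ω x * stateValue (q t ω) y) ^ 2
        = (γ * stateValue (q t ω) y) ^ 2 * c t b ω x ^ 2 := by ring
      _ ≤ (γ * C) ^ 2 * c t b ω x ^ 2 :=
          mul_le_mul_of_nonneg_right (sq_le_sq' (abs_le.1 hV).1 (abs_le.1 hV).2) (sq_nonneg _)
  · classical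
    rw [Set.indicator_apply]
    split_ifs <;> simp

theorem ae_tendsto_qStar [DecidableEq S] [DecidableEq A] [IsFiniteMeasure μ]
    (h : IsBatchQLearning M γ μ ℱ nx c q) (hγ0 : 0 ≤ γ) (hγ1 : γ < 1)
    (hdiv : ∀ x, ∀ᵐ ω ∂μ, Tendsto (fun n => ∑ t ∈ Finset.range n, ∑ b, c t b ω x) atTop atTop)
    (hsq : ∀ b x, ∀ᵐ ω ∂μ, Summable fun t => c t b ω x ^ 2) :
    ∀ᵐ ω ∂μ, Tendsto (fun t => q t ω) atTop (𝓝 (Function.uncurry (M.qStar γ))) := by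
  filter_upwards [ae_all_iff.2 hdiv, h.ae_step_eq_bellman_add_noise,
    ae_all_iff.2 fun x => ae_all_iff.2 fun b => ae_all_iff.2 fun y =>
      h.ae_exists_tendsto_sum_noise hγ0 hγ1 (hsq b x) y] with ω hdivω hstep hnoise
  refine tendsto_fixedPoint_of_asynchronous_approximation (M.contractingWith_bellman hγ0 hγ1)
    (M.isFixedPt_bellman_qStar hγ0 hγ1) (fun t x => h.sum_coeff_mem_Icc t ω x) hdivω
    (fun x => ?_) hstep
  choose L hL using hnoise x
  refine ⟨∑ b, ∑ y, L b y, (tendsto_finsetSum _ fun b _ => tendsto_finsetSum _ fun y _ =>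
    hL b y).congr fun n => ?_⟩
  simp only [Finset.sum_comm (s := Finset.range n)]

end IsBatchQLearning

end BatchQLearning

section Dase

variable {S A B : Type*} [DecidableEq S] [DecidableEq A] [Fintype B] {K : ℕ} {i : Fin K}

theorem shareWeight_mem_Icc (j : Fin K) {l : ℝ} (hl : l ∈ Set.Icc (0 : ℝ) 1) :
    shareWeight i j l ∈ Set.Icc (0 : ℝ) 1 := by
  unfold shareWeight
  split_ifs
  exacts [⟨zero_le_one, le_rfl⟩, hl]

/-- The coefficient of the temporal-difference error of transition `b` in the update of the table
entry `x` by `daseStep`. -/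
noncomputable def daseCoeff (i : Fin K) (owner : B → Fin K) (st : B → S) (ac : B → A)
    (η lam : B → ℝ) (b : B) (x : S × A) : ℝ :=
  (Fintype.card B : ℝ)⁻¹ *
    if st b = x.1 ∧ ac b = x.2 then η b * shareWeight i (owner b) (lam b) else 0

theorem eq_of_daseCoeff_ne_zero {owner : B → Fin K} {st : B → S} {ac : B → A} {η lam : B → ℝ}
    {b : B} {x : S × A} (hb : daseCoeff i owner st ac η lam b x ≠ 0) :
    st b = x.1 ∧ ac b = x.2 := by
  by_contra hne
  exact hb (by rw [daseCoeff, if_neg hne, mul_zero])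

theorem daseStep_eq_add_sum_daseCoeff_mul [Fintype S] [Fintype A] [Nonempty A]
    (M : FiniteMDP S A) (γ : ℝ) (owner : B → Fin K) (st : B → S) (ac : B → A) (nx : B → S)
    (η lam : B → ℝ) (Q : S → A → ℝ) (s : S) (a : A) :
    M.daseStep γ i owner st ac nx η lam Q s a =
      Q s a + ∑ b, daseCoeff i owner st ac η lam b (s, a) * M.tdError γ Q s a (nx b) := by
  simp only [daseStep, daseCoeff, Finset.mul_sum, mul_assoc, ite_mul, zero_mul]

section Bounds

variable {owner : B → Fin K} {st : B → S} {ac : B → A} {η lam : B → ℝ}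

theorem daseCoeff_nonneg (hη : ∀ b, 0 ≤ η b) (hlam : ∀ b, lam b ∈ Set.Icc (0 : ℝ) 1)
    (b : B) (x : S × A) : 0 ≤ daseCoeff i owner st ac η lam b x := by
  have hterm := mul_nonneg (hη b) (shareWeight_mem_Icc (i := i) (owner b) (hlam b)).1
  unfold daseCoeff
  positivity

theorem daseCoeff_le (hη : ∀ b, 0 ≤ η b) (hlam : ∀ b, lam b ∈ Set.Icc (0 : ℝ) 1)
    (b : B) (x : S × A) : daseCoeff i owner st ac η lam b x ≤
      (Fintype.card B : ℝ)⁻¹ * if st b = x.1 ∧ ac b = x.2 then η b else 0 := by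
  unfold daseCoeff
  gcongr
  split_ifs
  exacts [mul_le_of_le_one_right (hη b) (shareWeight_mem_Icc _ (hlam b)).2, le_rfl]

theorem sum_daseCoeff_le_one (hη : ∀ b, η b ∈ Set.Icc (0 : ℝ) 1)
    (hlam : ∀ b, lam b ∈ Set.Icc (0 : ℝ) 1) (x : S × A) :
    ∑ b, daseCoeff i owner st ac η lam b x ≤ 1 := by
  have hle : ∀ b, daseCoeff i owner st ac η lam b x ≤ (Fintype.card B : ℝ)⁻¹ := fun b => by
    refine (daseCoeff_le (fun b => (hη b).1) hlam b x).trans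
      (mul_le_of_le_one_right (by positivity) ?_)
    split_ifs
    exacts [(hη b).2, zero_le_one]
  calc ∑ b, daseCoeff i owner st ac η lam b x ≤ ∑ _b : B, (Fintype.card B : ℝ)⁻¹ :=
        Finset.sum_le_sum fun b _ => hle b
    _ ≤ 1 := by simpa using mul_inv_le_one

theorem daseCoeff_sq_le (hη : ∀ b, 0 ≤ η b) (hlam : ∀ b, lam b ∈ Set.Icc (0 : ℝ) 1)
    (b : B) (x : S × A) : daseCoeff i owner st ac η lam b x ^ 2 ≤
      ∑ b, if st b = x.1 ∧ ac b = x.2 then η b ^ 2 else 0 := by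
  have hvisit : ∀ b, 0 ≤ if st b = x.1 ∧ ac b = x.2 then η b else 0 := fun b => by
    split_ifs
    exacts [hη b, le_rfl]
  have hle : daseCoeff i owner st ac η lam b x ≤ if st b = x.1 ∧ ac b = x.2 then η b else 0 :=
    (daseCoeff_le hη hlam b x).trans (mul_le_of_le_one_left (hvisit b) (Nat.cast_inv_le_one _))
  calc daseCoeff i owner st ac η lam b x ^ 2
      ≤ (if st b = x.1 ∧ ac b = x.2 then η b else 0) ^ 2 :=
        pow_le_pow_left₀ (daseCoeff_nonneg hη hlam b x) hle 2
    _ ≤ ∑ b, (if st b = x.1 ∧ ac b = x.2 then η b else 0) ^ 2 :=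
        Finset.single_le_sum (f := fun b => (if st b = x.1 ∧ ac b = x.2 then η b else 0) ^ 2)
          (fun _ _ => sq_nonneg _) (Finset.mem_univ b)
    _ = ∑ b, if st b = x.1 ∧ ac b = x.2 then η b ^ 2 else 0 := by
        simp only [ite_pow, zero_pow two_ne_zero]

theorem inv_card_mul_sum_internal_le_sum_daseCoeff (hη : ∀ b, 0 ≤ η b)
    (hlam : ∀ b, lam b ∈ Set.Icc (0 : ℝ) 1) (x : S × A) :
    (Fintype.card B : ℝ)⁻¹ * ∑ b, (if owner b = i ∧ st b = x.1 ∧ ac b = x.2 then η b else 0) ≤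
      ∑ b, daseCoeff i owner st ac η lam b x := by
  rw [Finset.mul_sum]
  refine Finset.sum_le_sum fun b _ => ?_
  by_cases hb : owner b = i ∧ st b = x.1 ∧ ac b = x.2
  · simp only [daseCoeff, shareWeight, hb, and_self, if_true, mul_one, le_refl]
  · rw [if_neg hb, mul_zero]
    exact daseCoeff_nonneg hη hlam b x

end Bounds

theorem measurable_daseCoeff {Ω : Type*} {m : MeasurableSpace Ω} {owner : B → Ω → Fin K}
    {st : B → Ω → S} {ac : B → Ω → A} {η lam : B → Ω → ℝ} {b : B}
    (howner : Measurable[m, ⊤] (owner b)) (hst : Measurable[m, ⊤] (st b))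
    (hac : Measurable[m, ⊤] (ac b)) (hη : Measurable (η b)) (hlam : Measurable (lam b))
    (x : S × A) :
    Measurable fun ω => daseCoeff i (fun b => owner b ω) (fun b => st b ω) (fun b => ac b ω)
      (fun b => η b ω) (fun b => lam b ω) b x := by
  have hvisit : MeasurableSet {ω | st b ω = x.1 ∧ ac b ω = x.2} :=
    (hst (show MeasurableSet[⊤] {x.1} from trivial)).inter
      (hac (show MeasurableSet[⊤] {x.2} from trivial))
  have hinternal : MeasurableSet {ω | owner b ω = i} :=
    howner (show MeasurableSet[⊤] {i} from trivial)
  exact (Measurable.ite hvisit (hη.mul (Measurable.ite hinternal measurable_const hlam))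
    measurable_const).const_mul _

theorem tendsto_sum_daseCoeff_atTop {owner : ℕ → B → Fin K} {st : ℕ → B → S} {ac : ℕ → B → A}
    {η lam : ℕ → B → ℝ} (hη : ∀ t b, 0 ≤ η t b) (hlam : ∀ t b, lam t b ∈ Set.Icc (0 : ℝ) 1)
    {x : S × A} (hdiv : Tendsto (fun n => ∑ t ∈ Finset.range n, ∑ b,
      if owner t b = i ∧ st t b = x.1 ∧ ac t b = x.2 then η t b else 0) atTop atTop) :
    Tendsto (fun n => ∑ t ∈ Finset.range n, ∑ b,
      daseCoeff i (owner t) (st t) (ac t) (η t) (lam t) b x) atTop atTop := by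
  have hB : Nonempty B := by
    by_contra hB
    rw [not_nonempty_iff] at hB
    simp only [Finset.univ_eq_empty, Finset.sum_empty, Finset.sum_const_zero] at hdiv
    exact not_tendsto_const_atTop _ _ hdiv
  have hcard : 0 < (Fintype.card B : ℝ)⁻¹ := inv_pos.2 (Nat.cast_pos.2 Fintype.card_pos)
  refine tendsto_atTop_mono (fun n => ?_) (hdiv.const_mul_atTop hcard)
  rw [Finset.mul_sum]
  exact Finset.sum_le_sum fun t _ =>
    inv_card_mul_sum_internal_le_sum_daseCoeff (hη t) (hlam t) x

theorem summable_daseCoeff_sq {owner : ℕ → B → Fin K} {st : ℕ → B → S} {ac : ℕ → B → A}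
    {η lam : ℕ → B → ℝ} (hη : ∀ t b, 0 ≤ η t b) (hlam : ∀ t b, lam t b ∈ Set.Icc (0 : ℝ) 1)
    {x : S × A} (hsq : Summable fun t => ∑ b,
      if st t b = x.1 ∧ ac t b = x.2 then η t b ^ 2 else 0) (b : B) :
    Summable fun t => daseCoeff i (owner t) (st t) (ac t) (η t) (lam t) b x ^ 2 :=
  hsq.of_nonneg_of_le (fun _ => sq_nonneg _) fun t => daseCoeff_sq_le (hη t) (hlam t) b x

end Dase

end FiniteMDP

theorem theorem1 {S A B Ω : Type*} [Fintype S] [DecidableEq S] [Fintype A] [DecidableEq A]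
    [Nonempty A] [Fintype B] {mΩ : MeasurableSpace Ω} (μ : Measure Ω) [IsProbabilityMeasure μ]
    (M : FiniteMDP S A) (γ : ℝ) (hγ0 : 0 ≤ γ) (hγ1 : γ < 1)
    -- the `K` agents, and the agent whose table is studied
    (K : ℕ) (i : Fin K)
    -- the information available at the update steps
    (ℱ : Filtration ℕ mΩ)
    -- the batch of update step `t`: executing agent, state, action, next state, learning rate,
    -- similarity weight
    (owner : ℕ → B → Ω → Fin K) (st : ℕ → B → Ω → S) (ac : ℕ → B → Ω → A) (nx : ℕ → B → Ω → S)
    (η lam : ℕ → B → Ω → ℝ)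
    (howner : ∀ t b, Measurable[ℱ t, ⊤] (owner t b))
    (hst : ∀ t b, Measurable[ℱ t, ⊤] (st t b))
    (hac : ∀ t b, Measurable[ℱ t, ⊤] (ac t b))
    (hη : ∀ t b, Measurable[ℱ t] (η t b))
    (hlam : ∀ t b, Measurable[ℱ t] (lam t b))
    (hnx : ∀ t b, Measurable[ℱ (t + 1), ⊤] (nx t b))
    -- internal and external transitions are samples of the same MDP
    (hsample : ∀ t b y, μ[Set.indicator {ω | nx t b ω = y} (fun _ => (1 : ℝ)) | ℱ t]
      =ᵐ[μ] fun ω => M.p (st t b ω) (ac t b ω) y)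
    (hlam01 : ∀ t b ω, lam t b ω ∈ Set.Icc (0 : ℝ) 1)
    -- Robbins-Monro conditions on the learning rates
    (hη01 : ∀ t b ω, η t b ω ∈ Set.Icc (0 : ℝ) 1)
    (hdiv : ∀ s a, ∀ᵐ ω ∂μ, Tendsto (fun n => ∑ t ∈ Finset.range n, ∑ b,
      if owner t b ω = i ∧ st t b ω = s ∧ ac t b ω = a then η t b ω else 0) atTop atTop)
    (hsq : ∀ s a, ∀ᵐ ω ∂μ, Summable (fun t => ∑ b,
      if st t b ω = s ∧ ac t b ω = a then η t b ω ^ 2 else 0))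
    -- the table of agent `i`
    (Q : ℕ → Ω → S → A → ℝ)
    (hQ0 : ∀ s a, Measurable[ℱ 0] (fun ω => Q 0 ω s a))
    (hQ : ∀ t ω, Q (t + 1) ω = M.daseStep γ i (fun b => owner t b ω) (fun b => st t b ω)
      (fun b => ac t b ω) (fun b => nx t b ω) (fun b => η t b ω) (fun b => lam t b ω) (Q t ω)) :
    ∀ᵐ ω ∂μ, ∀ s a, Tendsto (fun t => Q t ω s a) atTop (𝓝 (M.qStar γ s a)) := by
  let c : ℕ → B → Ω → S × A → ℝ := fun t b ω => FiniteMDP.daseCoeff i (fun b => owner t b ω)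
    (fun b => st t b ω) (fun b => ac t b ω) (fun b => η t b ω) (fun b => lam t b ω) b
  have hη0 : ∀ ω t b, 0 ≤ η t b ω := fun ω t b => (hη01 t b ω).1
  have hbatch : M.IsBatchQLearning γ μ ℱ nx c fun t ω => Function.uncurry (Q t ω) :=
    { measurable_coeff := fun t b x => FiniteMDP.measurable_daseCoeff (howner t b) (hst t b)
        (hac t b) (hη t b) (hlam t b) x
      coeff_nonneg := fun t b ω x => FiniteMDP.daseCoeff_nonneg (hη0 ω t) (hlam01 t · ω) b x
      sum_coeff_le_one := fun t ω x => FiniteMDP.sum_daseCoeff_le_one (hη01 t · ω) (hlam01 t · ω) x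
      measurable_next := hnx
      condExp_next := fun t b x y => by
        filter_upwards [hsample t b y] with ω hω hc
        obtain ⟨hs, ha⟩ := FiniteMDP.eq_of_daseCoeff_ne_zero hc
        rw [hω, hs, ha]
      measurable_init := fun x => hQ0 x.1 x.2
      step := fun t ω x => (congrFun₂ (hQ t ω) x.1 x.2).trans
        (M.daseStep_eq_add_sum_daseCoeff_mul γ _ _ _ _ _ _ _ x.1 x.2) }
  have hdiv' : ∀ x, ∀ᵐ ω ∂μ, Tendsto (fun n => ∑ t ∈ Finset.range n, ∑ b, c t b ω x) atTop atTop :=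
    fun x => (hdiv x.1 x.2).mono fun ω =>
      FiniteMDP.tendsto_sum_daseCoeff_atTop (hη0 ω) (hlam01 · · ω)
  have hsq' : ∀ b x, ∀ᵐ ω ∂μ, Summable fun t => c t b ω x ^ 2 := fun b x =>
    (hsq x.1 x.2).mono fun ω hω => FiniteMDP.summable_daseCoeff_sq (hη0 ω) (hlam01 · · ω) hω b
  filter_upwards [hbatch.ae_tendsto_qStar hγ0 hγ1 hdiv' hsq'] with ω hω s a
  exact tendsto_pi_nhds.1 hω (s, a)
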